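/- A link diagram on the 2-sphere (possibly with several connected pieces, each having at least one crossing) is encoded by its underlying plane 4-valent graph with over/under information. At each crossing, place two dots in the two opposite corners that the over-arc sweeps when it is rotated counterclockwise up to the under-arc. Let $(G,M)$ be the cubic graph with perfect matching obtained from $D$ by replacing each crossing by an edge of $M$ joining its two dotted corners; that is, the edge has one end where the two half-arcs bounding one dotted corner meet, and its other end where the two half-arcs bounding the other dotted corner meet. A *Tait $n$-coloring* assigns one of $n$ colors to each edge of $G$ not in $M$ (that is, to each arc of $D$) so that at each edge of $M$ two different colors meet one end, and the same set of two colors meets the other end. The *Penrose–Kauffman (PK) polynomial* of $D$ is the unique polynomial $P\in\mathbb Z[q]$ such that, for every integer $n\ge 1$, $P(n)$ is the number of Tait $n$-colorings of $(G,M)$. The diagram $D$ is *alternating* if along each link component over- and under-crossings alternate, and *semi-reduced* if it does not consist of two boxes joined only through a single crossing, where each box receives the two half-arcs bounding one of the two dotted corners of that crossing (equivalently, if $G$ has no bridge). For an alternating plane diagram $D$, the *dual Tait graph* is the multigraph whose vertices are the regions of $D$ without dots (for a disconnected diagram, the regions of its connected pieces, each drawn on its own sphere) and which has one edge through each crossing,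 joining the regions of the two undotted corners at that crossing. **Theorem.** Let $D$ be a semi-reduced alternating plane link diagram with dual Tait graph $T$. Let $\bar T$ be a graph obtained from $T$ by removing all but one of the edges between each pair of joined vertices, and let $r$ be the number of removed edges. Let $\bar D$ be any alternating plane link diagram whose dual Tait graph is isomorphic to $\bar T$. Then the PK polynomials $P(q)$ of $D$ and $\bar P(q)$ of $\bar D$ satisfy $$P(q)=2^r\,\bar P(q).$$ -/

import Mathlib

open Polynomial
open scoped Graph

/-- Two multigraphs are isomorphic. -/
def Graph.IsIsomorphic {V₁ E₁ V₂ E₂ : Type*} (G : Graph V₁ E₁) (H : Graph V₂ E₂) : Prop :=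
  ∃ (f : V(G) ≃ V(H)) (g : E(G) ≃ E(H)), ∀ (e : E(G)) (u v : V(G)),
    G.IsLink e u v ↔ H.IsLink (g e) (f u) (f v)

/-- Deleting the set `R` of edges from `G` leaves exactly one edge between each pair of joined
vertices. -/
def Graph.LeavesOneEdge {V E : Type*} (G : Graph V E) (R : Set E) : Prop :=
  R ⊆ E(G) ∧ ∀ u v, G.Adj u v → ∃! e, (G.deleteEdges R).IsLink e u v

/-- A link diagram with crossing set `X` on a closed oriented surface, as a combinatorial map.
The four half-edges at the crossing `x` are `(x, 0), (x, 1), (x, 2), (x, 3)` in counterclockwise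
order; `(x, 0)` and `(x, 2)` belong to the under-arc, `(x, 1)` and `(x, 3)` to the over-arc.
The involution `arc` exchanges the two half-edges of each arc (edge of the underlying 4-valent
graph) of the diagram. Every component of the diagram runs through at least one crossing. -/
structure LinkDiagram (X : Type*) where
  /-- the other half of the arc containing a half-edge -/
  arc : Equiv.Perm (X × ZMod 4)
  arc_arc : ∀ d, arc (arc d) = d
  arc_ne : ∀ d, arc d ≠ d

namespace LinkDiagram

variable {X : Type*} (D : LinkDiagram X)

/-! ### Regions, planarity, dots -/

/-- The half-edge that follows counterclockwise at the same crossing. -/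
def rot : Equiv.Perm (X × ZMod 4) :=
  Equiv.prodCongr (Equiv.refl X) (Equiv.addRight 1)

/-- The corner `(x, i)` is the one between the half-edges `(x, i)` and `(x, i + 1)`, that is, to
the left of `(x, i)` when one leaves `x`. Walking along `(x, i)` with the region on the left, one
arrives through the half-edge `arc (x, i)`; the next corner of the region is the one clockwise of
that half-edge. -/
def faceNext : Equiv.Perm (X × ZMod 4) :=
  D.arc.trans rot.symm

/-- The regions of the diagram: the cycles of corners. For a diagram that is not connected these
are the regions of its connected pieces. -/
def Region : Type _ :=
  Quotient (Equiv.Perm.SameCycle.setoid D.faceNext)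

/-- The region containing a given corner. -/
def region (d : X × ZMod 4) : D.Region :=
  Quotient.mk (Equiv.Perm.SameCycle.setoid D.faceNext) d

/-- Two crossings are joined when some arc runs from one to the other. -/
def shadow : SimpleGraph X :=
  SimpleGraph.fromRel fun x y => ∃ i j, D.arc (x, i) = (y, j)

/-- The diagram is plane (drawn on the 2-sphere). With `n` crossings there are `2 n` arcs, so
Euler's formula `V - E + F = 2` for each connected piece adds up to `F = n + 2 C`, where `C` is
the number of connected pieces; a diagram of positive genus has fewer regions. -/
def IsPlane : Prop :=
  Nat.card D.Region = Nat.card X + 2 * Nat.card D.shadow.ConnectedComponent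

/-- `(x, 1)` and `(x, 3)` are the over-half-edges. -/
def IsOver (d : X × ZMod 4) : Prop := d.2 = 1 ∨ d.2 = 3

/-- Following a component one meets over- and under-crossings alternately: each arc leads from
an over-crossing to an under-crossing. -/
def IsAlternating : Prop :=
  ∀ d, IsOver (D.arc d) ↔ ¬ IsOver d

/-- The over-arc, when it is rotated counterclockwise up to the under-arc, sweeps the corners
`(x, 1)` and `(x, 3)`; these carry the two dots of the crossing. -/
def IsDotted (f : D.Region) : Prop :=
  ∃ x, f = D.region (x, 1) ∨ f = D.region (x, 3)

/-- The diagram consists of two boxes, joined only through one crossing `x`, where each box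
receives the two half-edges of `x` next to one of the two dots (so the smoothing of `x` still
joins the boxes, by two parallel arcs). `U` is the set of half-edges belonging to one of the
boxes. -/
def HasDottedCutCrossing : Prop :=
  ∃ (x : X) (U : Set (X × ZMod 4)),
    (∀ d, D.arc d ∈ U ↔ d ∈ U) ∧
    (∀ y, y ≠ x → ∀ i j, (y, i) ∈ U ↔ (y, j) ∈ U) ∧
    (x, 1) ∈ U ∧ (x, 2) ∈ U ∧ (x, 3) ∉ U ∧ (x, 0) ∉ U

/-- A diagram is semi-reduced if it is not of the form above. -/
def IsSemiReduced : Prop := ¬ D.HasDottedCutCrossing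

/-! ### The dual Tait graph -/

variable {D}

theorem IsAlternating.isOver_faceNext (h : D.IsAlternating) (d : X × ZMod 4) :
    IsOver (D.faceNext d) ↔ IsOver d := by
  have h1 : ∀ e : X × ZMod 4, IsOver (rot.symm e) ↔ ¬ IsOver e := by
    rintro ⟨x, i⟩
    change (i + -1 = 1 ∨ i + -1 = 3) ↔ ¬ (i = 1 ∨ i = 3)
    revert i
    decide
  change IsOver (rot.symm (D.arc d)) ↔ IsOver d
  rw [h1, h d, not_not]

theorem IsAlternating.isOver_of_region_eq (h : D.IsAlternating) {d e : X × ZMod 4}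
    (hde : D.region d = D.region e) : IsOver d ↔ IsOver e := by
  have hs : D.faceNext.SameCycle d e :=
    Quotient.exact (s := Equiv.Perm.SameCycle.setoid D.faceNext) hde
  obtain ⟨k, rfl⟩ := hs
  have key : ∀ k : ℤ, IsOver ((D.faceNext ^ k) d) ↔ IsOver d := fun k => by
    induction k using Int.induction_on with
    | zero => simp
    | succ k ih =>
      rw [← ih, add_comm, zpow_add, zpow_one, Equiv.Perm.mul_apply, h.isOver_faceNext]
    | pred k ih =>
      rw [← ih, ← h.isOver_faceNext ((D.faceNext ^ (-(k : ℤ) - 1)) d), ← Equiv.Perm.mul_apply,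
        ← zpow_one_add, add_sub_cancel]
  exact (key k).symm

theorem IsAlternating.not_isDotted (h : D.IsAlternating) {d : X × ZMod 4} (hd : ¬ IsOver d) :
    ¬ D.IsDotted (D.region d) := by
  rintro ⟨x, hx | hx⟩
  · exact hd ((h.isOver_of_region_eq hx).2 (Or.inl rfl))
  · exact hd ((h.isOver_of_region_eq hx).2 (Or.inr rfl))

variable (D)

/-- The dual Tait graph of an alternating diagram: its vertices are the undotted regions, and
each crossing `x` is an edge, which joins the regions of the two undotted corners at `x`. -/
def dualTaitGraph (h : D.IsAlternating) : Graph D.Region X where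
  vertexSet := {f | ¬ D.IsDotted f}
  IsLink x u v :=
    (u = D.region (x, 0) ∧ v = D.region (x, 2)) ∨ (u = D.region (x, 2) ∧ v = D.region (x, 0))
  edgeSet := Set.univ
  isLink_symm := fun _ _ => ⟨fun _ _ huv => huv.elim (fun p => Or.inr ⟨p.2, p.1⟩)
    fun p => Or.inl ⟨p.2, p.1⟩⟩
  eq_or_eq_of_isLink_of_isLink := by
    rintro x u v u' v' (⟨rfl, rfl⟩ | ⟨rfl, rfl⟩) (⟨rfl, rfl⟩ | ⟨rfl, rfl⟩) <;> simp
  edge_mem_iff_exists_isLink := fun x =>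
    ⟨fun _ => ⟨_, _, Or.inl ⟨rfl, rfl⟩⟩, fun _ => Set.mem_univ x⟩
  left_mem_of_isLink := by
    have h0 : ∀ x : X, ¬ IsOver (x, (0 : ZMod 4)) := fun x => by
      change ¬ ((0 : ZMod 4) = 1 ∨ (0 : ZMod 4) = 3); decide
    have h2 : ∀ x : X, ¬ IsOver (x, (2 : ZMod 4)) := fun x => by
      change ¬ ((2 : ZMod 4) = 1 ∨ (2 : ZMod 4) = 3); decide
    rintro x u v (⟨rfl, -⟩ | ⟨rfl, -⟩)
    · exact h.not_isDotted (h0 x)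
    · exact h.not_isDotted (h2 x)

/-! ### Tait colorings and the Penrose-Kauffman polynomial -/

/-- The cubic graph `G` with perfect matching `M` belonging to the diagram is obtained by
replacing each crossing `x` by an edge of `M` that joins the two dotted corners: one end of it
receives the half-edges `(x, 1), (x, 2)`, the other end `(x, 3), (x, 0)`. The edges of `G` outside
`M` are the arcs of the diagram. A Tait `n`-coloring colors these edges in such a way that at each
edge of `M` two different colors meet the one end, and the same set of colors meets the other
end. -/
def IsTaitColoring {n : ℕ} (c : X × ZMod 4 → Fin n) : Prop :=
  (∀ d, c (D.arc d) = c d) ∧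
  ∀ x, c (x, 1) ≠ c (x, 2) ∧
    ({c (x, 1), c (x, 2)} : Set (Fin n)) = {c (x, 3), c (x, 0)}

/-- The number of Tait `n`-colorings. -/
noncomputable def numTaitColorings (n : ℕ) : ℕ :=
  Nat.card {c : X × ZMod 4 → Fin n // D.IsTaitColoring c}

/-- Counting functions by their kernels: the number of functions `A → Fin n` whose kernel
satisfies `p` is an integral polynomial in `n`. -/
theorem exists_polynomial_card_ker {A : Type*} [Finite A] (p : Setoid A → Prop) :
    ∃ P : ℤ[X], ∀ n : ℕ,
      P.eval (n : ℤ) = (Nat.card {c : A → Fin n // p (Setoid.ker c)} : ℤ) := by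
  classical
  have : Fintype A := Fintype.ofFinite A
  have : Finite (Setoid A) :=
    Finite.of_injective (fun s : Setoid A => fun a b => s a b) fun s t h =>
      Setoid.ext fun a b => iff_of_eq (congrFun (congrFun h a) b)
  have : Fintype {s : Setoid A // p s} := Fintype.ofFinite _
  refine ⟨∑ s : {s : Setoid A // p s}, descPochhammer ℤ (Nat.card (Quotient s.1)), fun n => ?_⟩
  let e₁ : {c : A → Fin n // p (Setoid.ker c)} ≃
      Σ s : {s : Setoid A // p s}, {c : A → Fin n // Setoid.ker c = s.1} :=
    { toFun := fun c => ⟨⟨Setoid.ker c.1, c.2⟩, ⟨c.1, rfl⟩⟩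
      invFun := fun s => ⟨s.2.1, by rw [s.2.2]; exact s.1.2⟩
      left_inv := fun _ => rfl
      right_inv := by
        rintro ⟨⟨s, hs⟩, ⟨c, hc⟩⟩
        change Setoid.ker c = s at hc
        subst hc
        rfl }
  let e₂ : ∀ s : Setoid A, {c : A → Fin n // Setoid.ker c = s} ≃ (Quotient s ↪ Fin n) := fun s =>
    { toFun := fun c => ⟨Quotient.lift c.1 fun a b h => by
          have h' : Setoid.ker c.1 a b := by rw [c.2]; exact h
          exact h', fun a b => by
          induction a using Quotient.inductionOn
          induction b using Quotient.inductionOn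
          intro h
          refine Quotient.sound ?_
          have h' : Setoid.ker c.1 _ _ := h
          rw [c.2] at h'
          exact h'⟩
      invFun := fun f => ⟨fun a => f (Quotient.mk s a), Setoid.ext fun a b => by
        rw [Setoid.ker_def, f.injective.eq_iff]
        exact Quotient.eq⟩
      left_inv := fun _ => rfl
      right_inv := fun f => by
        ext a
        induction a using Quotient.inductionOn
        rfl }
  rw [Nat.card_congr (e₁.trans (Equiv.sigmaCongrRight fun s => e₂ s.1)), Nat.card_sigma,
    eval_finsetSum]
  push_cast
  refine Finset.sum_congr rfl fun s _ => ?_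
  rw [descPochhammer_eval_eq_descFactorial, Nat.card_eq_fintype_card, Nat.card_eq_fintype_card,
    Fintype.card_embedding_eq, Fintype.card_fin]

theorem isTaitColoring_iff {n : ℕ} (c : X × ZMod 4 → Fin n) :
    D.IsTaitColoring c ↔ (fun s : Setoid (X × ZMod 4) => (∀ d, s (D.arc d) d) ∧
      ∀ x, ¬ s (x, 1) (x, 2) ∧ ((s (x, 1) (x, 3) ∧ s (x, 2) (x, 0)) ∨
        (s (x, 1) (x, 0) ∧ s (x, 2) (x, 3)))) (Setoid.ker c) := by
  simp only [IsTaitColoring, Setoid.ker_def, Set.pair_eq_pair_iff, ne_eq]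

theorem existsUnique_pkPolynomial [Finite X] :
    ∃! P : ℤ[X], ∀ n : ℕ, 0 < n → P.eval (n : ℤ) = (D.numTaitColorings n : ℤ) := by
  obtain ⟨P, hP⟩ := exists_polynomial_card_ker (A := X × ZMod 4) fun s =>
    (∀ d, s (D.arc d) d) ∧ ∀ x, ¬ s (x, 1) (x, 2) ∧ ((s (x, 1) (x, 3) ∧ s (x, 2) (x, 0)) ∨
      (s (x, 1) (x, 0) ∧ s (x, 2) (x, 3)))
  have hP' : ∀ n : ℕ, P.eval (n : ℤ) = (D.numTaitColorings n : ℤ) := fun n => by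
    rw [hP n, numTaitColorings]
    congr 1
    exact Nat.card_congr (Equiv.subtypeEquivRight fun c => (D.isTaitColoring_iff c).symm)
  refine ⟨P, fun n _ => hP' n, fun Q hQ => ?_⟩
  refine Polynomial.eq_of_infinite_eval_eq Q P ?_
  refine Set.infinite_of_injective_forall_mem (f := fun n : ℕ => ((n + 1 : ℕ) : ℤ))
    (fun a b h => by simpa using h) fun n => ?_
  change Q.eval _ = P.eval _
  rw [hQ (n + 1) n.succ_pos, hP' (n + 1)]

/-- The Penrose-Kauffman polynomial: the unique integral polynomial whose value at each positive
integer `n` is the number of Tait `n`-colorings. -/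
noncomputable def pkPolynomial [Finite X] : ℤ[X] :=
  D.existsUnique_pkPolynomial.choose

end LinkDiagram

/-! Two integer polynomials that agree at all powers of two are equal, so it suffices to count Tait
colorings with `2 ^ k` colors. Take the colors to be the vectors of `W = Fin k → ZMod 2`. At a
crossing every color of a Tait coloring occurs an even number of times, so the coloring is a
`W`-valued cycle of the 4-valent graph.

Such a cycle has two sums at each crossing: `c (x, 1) + c (x, 2)` over a dotted corner and `c (x, 0)
+ c (x, 1)` over an undotted one. On a plane alternating diagram the regions are checkerboard
colored by dots, and planar duality (`exists_potential`) identifies the possible pairs of sums: the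
first is any coboundary of a vertex labelling `f` of the dual Tait graph, the second any flow on
that graph. The Tait condition says that the coboundary vanishes nowhere and that the flow is at
each edge zero or equal to the coboundary. The flow is thus a set of edges: its indicator times the
coboundary. This turns Tait colorings into Penrose pairs, which depend on the abstract graph only.
Passing to sums forgets one vector per connected piece, and so does passing from `f` to its
coboundary (`card_ker_cycleHom`), so the two counts agree.

Parallel edges carry the same value of the coboundary, so only the parity of the number chosen in a
parallel class matters. Hence each removed edge contributes a free bit, that is, a factor 2
(`Graph.numPenrosePairs_deleteEdges`). -/

namespace LinkDiagram

variable {X : Type*} (D : LinkDiagram X)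

/-! ### Half-edges, corners and regions -/

instance [Finite X] : Finite D.Region := by
  unfold Region
  infer_instance

theorem rot_apply (x : X) (i : ZMod 4) : rot (x, i) = (x, i + 1) := rfl

theorem rot_symm_apply (x : X) (i : ZMod 4) : rot.symm (x, i) = (x, i - 1) :=
  congrArg (Prod.mk x) (sub_eq_add_neg i 1).symm

theorem rot_faceNext (d : X × ZMod 4) : rot (D.faceNext d) = D.arc d :=
  Equiv.apply_symm_apply _ _

theorem region_faceNext (d : X × ZMod 4) : D.region (D.faceNext d) = D.region d :=
  Quotient.sound (s := Equiv.Perm.SameCycle.setoid D.faceNext)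
    (Equiv.Perm.SameCycle.refl _ _).apply_left

/-- Both corners border the arc of `d` on its right side; the region of `d` itself is on the left.
So `region d` and `region (arc d)` are the two sides of an arc. -/
theorem region_rot_symm (d : X × ZMod 4) : D.region (rot.symm d) = D.region (D.arc d) := by
  rw [← D.region_faceNext (D.arc d)]
  simp [faceNext, D.arc_arc]

theorem region_surjective : Function.Surjective D.region := Quotient.mk_surjective

instance (d : X × ZMod 4) : Decidable (IsOver d) := inferInstanceAs (Decidable (_ ∨ _))

theorem not_isOver_zero (x : X) : ¬ IsOver (x, (0 : ZMod 4)) := by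
  change ¬ ((0 : ZMod 4) = 1 ∨ (0 : ZMod 4) = 3)
  decide

theorem not_isOver_two (x : X) : ¬ IsOver (x, (2 : ZMod 4)) := by
  change ¬ ((2 : ZMod 4) = 1 ∨ (2 : ZMod 4) = 3)
  decide

theorem isOver_one (x : X) : IsOver (x, (1 : ZMod 4)) := Or.inl rfl

theorem isOver_three (x : X) : IsOver (x, (3 : ZMod 4)) := Or.inr rfl

theorem sum_half_edges [Fintype X] {M : Type*} [AddCommMonoid M] (F : X × ZMod 4 → M) :
    ∑ d, F d = ∑ x, (F (x, 0) + F (x, 1) + F (x, 2) + F (x, 3)) := by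
  rw [Fintype.sum_prod_type]
  exact Finset.sum_congr rfl fun x _ => Fin.sum_univ_four fun i : Fin 4 => F (x, i)

/-! ### Planar duality over `ZMod 2` between the two checkerboard graphs -/

variable {D}

/-- Walking around the region, `rot` of the next corner is `arc` of the present one. Reindexing
along `faceNext` therefore makes the two halves of the sum equal, and they cancel. -/
theorem sum_region_eq_zero [Fintype X] [DecidableEq D.Region] {M : Type*} [AddCommMonoid M]
    (h2 : ∀ m : M, m + m = 0) (A : X × ZMod 4 → M) (R : D.Region) :
    ∑ d, (if D.region d = R then A (rot d) + A (D.arc d) else 0) = 0 := by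
  have h1 : ∑ d, (if D.region d = R then A (rot d) else 0) =
      ∑ d, (if D.region d = R then A (D.arc d) else 0) := by
    rw [← Equiv.sum_comp D.faceNext]
    simp only [region_faceNext, rot_faceNext]
  have h3 : ∀ d, (if D.region d = R then A (rot d) + A (D.arc d) else 0) =
      (if D.region d = R then A (rot d) else 0) + (if D.region d = R then A (D.arc d) else 0) := by
    intro d; split_ifs <;> simp
  rw [Finset.sum_congr rfl fun d _ => h3 d, Finset.sum_add_distrib, h1, h2]

variable (D) in
/-- The incidence matrix of the graph whose vertices are all the regions and in which each crossing
gives two edges, joining the regions of its two pairs of opposite corners. -/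
def cornerMatrix [DecidableEq D.Region] : Matrix (X × Bool) D.Region (ZMod 2) :=
  fun p R => (if D.region (p.1, bif p.2 then 1 else 0) = R then 1 else 0) +
    (if D.region (p.1, bif p.2 then 3 else 2) = R then 1 else 0)

theorem cornerMatrix_mulVec [DecidableEq D.Region] [Fintype D.Region] (f : D.Region → ZMod 2)
    (x : X) (b : Bool) :
    (D.cornerMatrix.mulVec f) (x, b) = f (D.region (x, bif b then 1 else 0)) +
      f (D.region (x, bif b then 3 else 2)) := by
  simp [cornerMatrix, Matrix.mulVec, dotProduct, add_mul, Finset.sum_add_distrib]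

theorem cornerMatrix_transpose_mulVec [DecidableEq D.Region] [Fintype X]
    (g : X × Bool → ZMod 2) (R : D.Region) :
    (D.cornerMatrix.transpose.mulVec g) R =
      ∑ d : X × ZMod 4, if D.region d = R then g (d.1, decide (IsOver d)) else 0 := by
  rw [sum_half_edges]
  simp only [not_isOver_zero, not_isOver_two, isOver_one, isOver_three, Matrix.mulVec, dotProduct, Fintype.sum_prod_type, Fintype.sum_bool,
    Matrix.transpose_apply, cornerMatrix, decide_true, decide_false, cond_true, cond_false,
    add_mul, ite_mul, one_mul, zero_mul]
  refine Finset.sum_congr rfl fun x _ => ?_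
  ac_rfl

end LinkDiagram

namespace LinkDiagram

variable {X : Type*} {D : LinkDiagram X}

theorem forall_half_edge {p : X × ZMod 4 → Prop} :
    (∀ d, p d) ↔ ∀ x, p (x, 0) ∧ p (x, 1) ∧ p (x, 2) ∧ p (x, 3) := by
  refine ⟨fun h x => ⟨h _, h _, h _, h _⟩, ?_⟩
  rintro h ⟨x, i⟩
  obtain ⟨h0, h1, h2, h3⟩ := h x
  have hi : i = 0 ∨ i = 1 ∨ i = 2 ∨ i = 3 := by revert i; decide
  rcases hi with rfl | rfl | rfl | rfl <;> assumption

theorem isOver_rot_symm (d : X × ZMod 4) : IsOver (rot.symm d) ↔ ¬ IsOver d := by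
  revert d
  rw [forall_half_edge]
  intro x
  simp only [rot_symm_apply, IsOver]
  decide

theorem apply_region_eq_of_opposite {α : Type*} {f : D.Region → α}
    (hf : ∀ x, f (D.region (x, 0)) = f (D.region (x, 2)) ∧
      f (D.region (x, 1)) = f (D.region (x, 3))) (d : X × ZMod 4) :
    f (D.region d) = f (D.region (d.1, bif decide (IsOver d) then 1 else 0)) := by
  revert d
  rw [forall_half_edge]
  intro x
  simp [not_isOver_zero, not_isOver_two, isOver_one, isOver_three, (hf x).1, (hf x).2]

/-- The two regions beside an arc are seen from both of its ends. Alternation ensures that each of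
them has the same kind of corner, dotted or undotted, at both ends. -/
theorem IsAlternating.apply_region_arc (halt : D.IsAlternating) {α : Type*} {f : D.Region → α}
    (hf : ∀ x, f (D.region (x, 0)) = f (D.region (x, 2)) ∧
      f (D.region (x, 1)) = f (D.region (x, 3))) (d : X × ZMod 4) (b : Bool) :
    f (D.region (d.1, bif b then 1 else 0)) =
      f (D.region ((D.arc d).1, bif b then 1 else 0)) := by
  have h1 := apply_region_eq_of_opposite hf d
  have h2 := apply_region_eq_of_opposite hf (D.faceNext d)
  have h3 := apply_region_eq_of_opposite hf (rot.symm d)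
  have h4 := apply_region_eq_of_opposite hf (D.arc d)
  simp only [region_faceNext, halt.isOver_faceNext d] at h2
  simp only [region_rot_symm, isOver_rot_symm d] at h3
  simp only [halt d] at h4
  have h5 : (rot.symm d).1 = d.1 := rfl
  have h6 : (D.faceNext d).1 = (D.arc d).1 := rfl
  rw [h5] at h3
  rw [h6] at h2
  by_cases hd : IsOver d <;> cases b <;> simp_all

theorem IsAlternating.apply_region_of_reachable (halt : D.IsAlternating) {α : Type*}
    {f : D.Region → α} (hf : ∀ x, f (D.region (x, 0)) = f (D.region (x, 2)) ∧
      f (D.region (x, 1)) = f (D.region (x, 3))) {x y : X} (h : D.shadow.Reachable x y)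
    (b : Bool) :
    f (D.region (x, bif b then 1 else 0)) = f (D.region (y, bif b then 1 else 0)) := by
  obtain ⟨w⟩ := h
  induction w with
  | nil => rfl
  | cons hadj _ ih =>
    rw [← ih]
    obtain ⟨-, ⟨i, j, h⟩ | ⟨i, j, h⟩⟩ := (SimpleGraph.fromRel_adj _ _ _).1 hadj
    · exact (halt.apply_region_arc hf (_, i) b).trans (by rw [h])
    · exact ((halt.apply_region_arc hf (_, i) b).trans (by rw [h])).symm

/-- An element of the kernel agrees on opposite corners, so on each connected piece it is determined
by one value on dotted and one on undotted regions. The kernel has dimension at most `2 C`, and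
Euler's formula `F = n + 2 C` leaves rank at least `n`. -/
theorem le_rank_cornerMatrix [Fintype X] [Fintype D.Region] [DecidableEq D.Region]
    (hplane : D.IsPlane) (halt : D.IsAlternating) :
    Fintype.card X ≤ D.cornerMatrix.rank := by
  classical
  have hker : ∀ f ∈ LinearMap.ker D.cornerMatrix.mulVecLin, ∀ x,
      f (D.region (x, 0)) = f (D.region (x, 2)) ∧ f (D.region (x, 1)) = f (D.region (x, 3)) := by
    intro f hf x
    have h : ∀ b : Bool, _ := fun b => congrFun (LinearMap.mem_ker.1 hf) (x, b)
    simp only [Matrix.mulVecLin_apply, cornerMatrix_mulVec, Pi.zero_apply] at h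
    exact ⟨CharTwo.add_eq_zero.1 (h false), CharTwo.add_eq_zero.1 (h true)⟩
  let ev : LinearMap.ker D.cornerMatrix.mulVecLin →ₗ[ZMod 2]
      (D.shadow.ConnectedComponent × Bool → ZMod 2) :=
    (LinearMap.funLeft (ZMod 2) (ZMod 2) fun p : D.shadow.ConnectedComponent × Bool =>
      D.region (p.1.out, bif p.2 then 1 else 0)).comp (Submodule.subtype _)
  have hev : Function.Injective ev := by
    intro f g h
    refine Subtype.ext (funext fun R => ?_)
    obtain ⟨d, rfl⟩ := D.region_surjective R
    have key : ∀ f : LinearMap.ker D.cornerMatrix.mulVecLin, f.1 (D.region d) =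
        ev f (D.shadow.connectedComponentMk d.1, decide (IsOver d)) := by
      intro f
      rw [apply_region_eq_of_opposite (hker f.1 f.2)]
      refine halt.apply_region_of_reachable (hker f.1 f.2) ?_ _
      exact (SimpleGraph.ConnectedComponent.exact (Quot.out_eq _)).symm
    rw [key, key, h]
  have h1 := LinearMap.finrank_le_finrank_of_injective hev
  have h2 := LinearMap.finrank_range_add_finrank_ker D.cornerMatrix.mulVecLin
  rw [Module.finrank_fintype_fun_eq_card] at h1 h2
  have h3 : D.cornerMatrix.rank =
    Module.finrank (ZMod 2) (LinearMap.range D.cornerMatrix.mulVecLin) := rfl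
  have h4 := hplane
  rw [IsPlane, Nat.card_eq_fintype_card, Nat.card_eq_fintype_card,
    Nat.card_eq_fintype_card] at h4
  rw [Fintype.card_prod, Fintype.card_bool] at h1
  omega

/-- On a plane diagram, a function of pairs of opposite corners whose sum over each region is zero
is the coboundary of a function of regions, transported across the crossings. -/
theorem exists_potential [Fintype X] [DecidableEq D.Region]
    (hplane : D.IsPlane) (halt : D.IsAlternating) (G : X × ZMod 4 → ZMod 2)
    (hG : ∀ d, G (rot (rot d)) = G d)
    (hsum : ∀ R : D.Region, ∑ d, (if D.region d = R then G d else 0) = 0) :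
    ∃ f : D.Region → ZMod 2, ∀ d, G d = f (D.region (rot d)) + f (D.region (rot.symm d)) := by
  classical
  have : Fintype D.Region := Fintype.ofFinite _
  -- Crossing over to the dual edge: `s` exchanges the two pairs of opposite corners at each
  -- crossing. Transported this way, coboundaries become cycles.
  let s : (X × Bool → ZMod 2) ≃ₗ[ZMod 2] (X × Bool → ZMod 2) :=
    LinearEquiv.funCongrLeft (ZMod 2) (ZMod 2) (Equiv.prodCongr (Equiv.refl X) Equiv.boolNot)
  have hs : ∀ g x b, s g (x, b) = g (x, !b) := fun g x b => rfl
  have hle : LinearMap.range (s.toLinearMap ∘ₗ D.cornerMatrix.mulVecLin) ≤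
      LinearMap.ker D.cornerMatrix.transpose.mulVecLin := by
    rintro _ ⟨f, rfl⟩
    rw [LinearMap.mem_ker]
    ext R
    rw [Matrix.mulVecLin_apply, cornerMatrix_transpose_mulVec, Pi.zero_apply]
    refine Eq.trans ?_ (sum_region_eq_zero CharTwo.add_self_eq_zero (fun d => f (D.region d)) R)
    refine Finset.sum_congr rfl fun d hd => if_congr Iff.rfl ?_ rfl
    clear hd
    change s (D.cornerMatrix.mulVec f) _ = _
    rw [hs, cornerMatrix_mulVec, ← region_rot_symm]
    revert d
    rw [forall_half_edge]
    intro x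
    simp only [not_isOver_zero, not_isOver_two, isOver_one, isOver_three, rot_symm_apply, rot_apply]
    refine ⟨?_, ?_, ?_, ?_⟩
    · rfl
    · exact add_comm _ _
    · exact add_comm _ _
    · rfl
  have hrk : Module.finrank (ZMod 2) (LinearMap.range (s.toLinearMap ∘ₗ D.cornerMatrix.mulVecLin)) =
      D.cornerMatrix.rank := by
    rw [LinearMap.range_comp]
    exact LinearEquiv.finrank_map_eq s _
  have h1 := LinearMap.finrank_range_add_finrank_ker D.cornerMatrix.transpose.mulVecLin
  have h2 : Module.finrank (ZMod 2) (LinearMap.range D.cornerMatrix.transpose.mulVecLin) =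
    D.cornerMatrix.rank := D.cornerMatrix.rank_transpose
  have h3 := le_rank_cornerMatrix hplane halt
  rw [Module.finrank_fintype_fun_eq_card, Fintype.card_prod, Fintype.card_bool] at h1
  -- The cycles have dimension `2 n - rank ≤ n ≤ rank`, so the inclusion `hle` is an equality.
  have heq := Submodule.eq_of_le_of_finrank_le hle (by omega)
  have hG0 : ∀ x, G (x, 2) = G (x, 0) := fun x => hG (x, 0)
  have hG1 : ∀ x, G (x, 3) = G (x, 1) := fun x => hG (x, 1)
  have hmem : (fun p : X × Bool => G (p.1, bif p.2 then 1 else 0)) ∈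
      LinearMap.ker D.cornerMatrix.transpose.mulVecLin := by
    rw [LinearMap.mem_ker]
    ext R
    rw [Matrix.mulVecLin_apply, cornerMatrix_transpose_mulVec, Pi.zero_apply]
    refine Eq.trans ?_ (hsum R)
    refine Finset.sum_congr rfl fun d hd => if_congr Iff.rfl ?_ rfl
    clear hd
    revert d
    rw [forall_half_edge]
    intro x
    simp [not_isOver_zero, not_isOver_two, isOver_one, isOver_three, hG0, hG1]
  rw [← heq] at hmem
  obtain ⟨f, hf⟩ := hmem
  have hf' : ∀ x b, D.cornerMatrix.mulVec f (x, !b) = G (x, bif b then 1 else 0) :=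
    fun x b => congrFun hf (x, b)
  simp only [cornerMatrix_mulVec] at hf'
  refine ⟨f, ?_⟩
  rw [forall_half_edge]
  intro x
  simp only [rot_symm_apply, rot_apply, hG0, hG1]
  refine ⟨?_, ?_, ?_, ?_⟩
  · exact (hf' x false).symm
  · exact (hf' x true).symm.trans (add_comm _ _)
  · exact (hf' x false).symm.trans (add_comm _ _)
  · exact (hf' x true).symm

end LinkDiagram

/-! ### Penrose pairs and parallel edges -/

namespace Graph

variable {V E : Type*} (G : Graph V E) {W : Type*} [AddCommGroup W]

/-- The sum of the values of `f` at the two ends of an edge. -/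
noncomputable def endSum (f : V(G) → W) (e : E(G)) : W :=
  f ⟨_, (G.exists_isLink_of_mem_edgeSet e.2).choose_spec.choose_spec.left_mem⟩ +
    f ⟨_, (G.exists_isLink_of_mem_edgeSet e.2).choose_spec.choose_spec.right_mem⟩

variable {G} in
theorem endSum_eq (f : V(G) → W) {e : E(G)} {u v : V(G)} (h : G.IsLink e u v) :
    G.endSum f e = f u + f v := by
  obtain ⟨u, hu⟩ := u
  obtain ⟨v, hv⟩ := v
  have h' := (G.exists_isLink_of_mem_edgeSet e.2).choose_spec.choose_spec
  rcases h.eq_and_eq_or_eq_and_eq h' with ⟨h1, h2⟩ | ⟨h1, h2⟩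
  · simp only at h1 h2
    subst h1 h2
    rfl
  · simp only at h1 h2
    subst h1 h2
    exact add_comm _ _

variable [Module (ZMod 2) W]

open Classical in
/-- A proper coloring `f` of the vertices together with a set of edges (with indicator function
`x`), such that the coboundary of `f` sums to zero over the edges of the set at each vertex. -/
def IsPenrosePair [Fintype E(G)] (p : (V(G) → W) × (E(G) → ZMod 2)) : Prop :=
  (∀ (e : E(G)) (u v : V(G)), G.IsLink e u v → p.1 u ≠ p.1 v) ∧
    ∀ v : V(G), ∑ e : E(G), (if G.Inc e v then p.2 e • G.endSum p.1 e else 0) = 0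

variable (W) in
/-- The number of Penrose pairs. -/
noncomputable def numPenrosePairs [Fintype E(G)] : ℕ :=
  Nat.card {p : (V(G) → W) × (E(G) → ZMod 2) // G.IsPenrosePair p}

variable {G}

theorem numPenrosePairs_congr {V' E' : Type*} {H : Graph V' E'} [Fintype E(G)] [Fintype E(H)]
    (h : G.IsIsomorphic H) : G.numPenrosePairs W = H.numPenrosePairs W := by
  classical
  obtain ⟨α, β, hαβ⟩ := h
  have hinc : ∀ (e : E(G)) (v : V(G)), G.Inc e v ↔ H.Inc (β e) (α v) := by
    intro e v
    constructor
    · rintro ⟨u, hu⟩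
      exact ⟨_, (hαβ e v ⟨u, hu.right_mem⟩).1 hu⟩
    · rintro ⟨u, hu⟩
      refine ⟨α.symm ⟨u, hu.right_mem⟩, (hαβ e v (α.symm ⟨u, hu.right_mem⟩)).2 ?_⟩
      simpa using hu
  have hsum : ∀ (f : V(G) → W) (e : E(G)), H.endSum (f ∘ α.symm) (β e) = G.endSum f e := by
    intro f e
    obtain ⟨u, v, huv⟩ := G.exists_isLink_of_mem_edgeSet e.2
    rw [endSum_eq (u := ⟨u, huv.left_mem⟩) (v := ⟨v, huv.right_mem⟩) f huv,
      endSum_eq (f ∘ α.symm) ((hαβ e ⟨u, huv.left_mem⟩ ⟨v, huv.right_mem⟩).1 huv)]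
    simp
  refine Nat.card_congr (Equiv.subtypeEquiv
    ((Equiv.arrowCongr α (Equiv.refl _)).prodCongr (Equiv.arrowCongr β (Equiv.refl _))) ?_)
  rintro ⟨f, x⟩
  change _ ↔ H.IsPenrosePair (f ∘ α.symm, x ∘ β.symm)
  refine and_congr ⟨fun h e u v huv => ?_, fun h e u v huv => ?_⟩
    ⟨fun h v => ?_, fun h v => ?_⟩
  · refine h (β.symm e) (α.symm u) (α.symm v) ((hαβ _ _ _).2 ?_)
    simpa using huv
  · have := h _ _ _ ((hαβ e u v).1 huv)
    simpa using this
  · refine Eq.trans ?_ (h (α.symm v))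
    refine (Fintype.sum_equiv β _ _ fun e => ?_).symm
    simp only [hinc, Equiv.apply_symm_apply, hsum, Function.comp_apply, Equiv.symm_apply_apply]
  · refine Eq.trans ?_ (h (α v))
    refine Fintype.sum_equiv β _ _ fun e => ?_
    simp only [hinc, hsum, Function.comp_apply, Equiv.symm_apply_apply]

/-- Properness of `f` ignores multiplicities, and in the vertex sums a removed edge contributes like
the parallel edge that is kept. Its coefficient can be moved there and then chosen freely. -/
theorem numPenrosePairs_deleteEdges [Finite E] {R : Set E} [Fintype E(G)]
    [Fintype E(G.deleteEdges R)] (hR : G.LeavesOneEdge R) :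
    G.numPenrosePairs W = 2 ^ R.ncard * (G.deleteEdges R).numPenrosePairs W := by
  classical
  have : Fintype E := Fintype.ofFinite E
  obtain ⟨hRE, hR⟩ := hR
  have hEH : ∀ {e}, e ∈ E(G.deleteEdges R) ↔ e ∈ E(G) ∧ e ∉ R := by
    intro e; simp
  have hlink : ∀ {e u v}, (G.deleteEdges R).IsLink e u v ↔ G.IsLink e u v ∧ e ∉ R := by
    intro e u v; simp
  have hincH : ∀ {e v}, (G.deleteEdges R).Inc e v ↔ G.Inc e v ∧ e ∉ R := by
    intro e v; simp
  -- `ρ r` will be the kept edge parallel to the removed edge `r`.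
  have hrep : ∀ r : R, ∃ e : E(G.deleteEdges R), ∀ u v, G.IsLink r u v ↔ G.IsLink e u v := by
    rintro ⟨r, hr⟩
    obtain ⟨u, v, huv⟩ := G.exists_isLink_of_mem_edgeSet (hRE hr)
    obtain ⟨e, he, -⟩ := hR u v ⟨r, huv⟩
    refine ⟨⟨e, he.edge_mem⟩, fun u' v' => ?_⟩
    rw [huv.isLink_iff, (hlink.1 he).1.isLink_iff]
  choose ρ hρ using hrep
  have hρinc : ∀ r v, G.Inc (ρ r) v ↔ G.Inc r v := fun r v =>
    exists_congr fun u => (hρ r v u).symm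
  let i : E(G.deleteEdges R) → E(G) := fun e => ⟨e, (hEH.1 e.2).1⟩
  let k : R → E(G) := fun r => ⟨r, hRE r.2⟩
  have hsumH : ∀ (f : V(G) → W) (e : E(G.deleteEdges R)),
      (G.deleteEdges R).endSum f e = G.endSum f (i e) := by
    intro f e
    obtain ⟨u, v, huv⟩ := G.exists_isLink_of_mem_edgeSet (i e).2
    rw [endSum_eq (u := ⟨u, huv.left_mem⟩) (v := ⟨v, huv.right_mem⟩) f huv]
    exact endSum_eq (G := G.deleteEdges R) (u := ⟨u, huv.left_mem⟩) (v := ⟨v, huv.right_mem⟩) f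
      (hlink.2 ⟨huv, (hEH.1 e.2).2⟩)
  have hsumρ : ∀ (f : V(G) → W) (r : R), G.endSum f (k r) = G.endSum f (i (ρ r)) := by
    intro f r
    obtain ⟨u, v, huv⟩ := G.exists_isLink_of_mem_edgeSet (k r).2
    rw [endSum_eq (u := ⟨u, huv.left_mem⟩) (v := ⟨v, huv.right_mem⟩) f huv,
      endSum_eq (e := i (ρ r)) (u := ⟨u, huv.left_mem⟩) (v := ⟨v, huv.right_mem⟩) f
        ((hρ r u v).1 huv)]
  -- A shear: the coefficients on `R` are recorded and also added to those of the kept edges. In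
  -- characteristic 2 the same addition undoes it.
  let Φ : (V(G) → W) × (E(G) → ZMod 2) ≃
      (R → ZMod 2) × ((V(G) → W) × (E(G.deleteEdges R) → ZMod 2)) :=
    { toFun := fun p => (fun r => p.2 (k r), p.1,
        fun e => p.2 (i e) + ∑ r, if ρ r = e then p.2 (k r) else 0)
      invFun := fun q => (q.2.1, fun e => if h : e.1 ∈ R then q.1 ⟨e, h⟩ else
        q.2.2 ⟨e, hEH.2 ⟨e.2, h⟩⟩ + ∑ r, if ρ r = ⟨e, hEH.2 ⟨e.2, h⟩⟩ then q.1 r else 0)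
      left_inv := by
        rintro ⟨f, x⟩
        refine Prod.ext rfl (funext fun e => ?_)
        by_cases h : e.1 ∈ R
        · simp [h, k]
        · simp [h, k, i, add_assoc, CharTwo.add_self_eq_zero]
      right_inv := by
        rintro ⟨a, f, b⟩
        refine Prod.ext (funext fun r => ?_) (Prod.ext rfl (funext fun e => ?_))
        · simp [k]
        · have h : e.1 ∉ R := (hEH.1 e.2).2
          simp [h, k, i, add_assoc, CharTwo.add_self_eq_zero] }
  have hsplit : ∀ F : E(G) → W, ∑ e, F e = ∑ r, F (k r) + ∑ e, F (i e) := by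
    intro F
    let σ : R ⊕ E(G.deleteEdges R) ≃ E(G) :=
      { toFun := Sum.elim k i
        invFun := fun e => if h : e.1 ∈ R then Sum.inl ⟨e, h⟩ else Sum.inr ⟨e, hEH.2 ⟨e.2, h⟩⟩
        left_inv := by
          rintro (r | e)
          · simp [k]
          · have h : e.1 ∉ R := (hEH.1 e.2).2
            simp [i, h]
        right_inv := by
          intro e
          by_cases h : e.1 ∈ R <;> simp [h, k, i] }
    rw [← Equiv.sum_comp σ, Fintype.sum_sum_type]
    rfl
  have hΦ : ∀ p, G.IsPenrosePair p ↔ (G.deleteEdges R).IsPenrosePair (Φ p).2 := by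
    rintro ⟨f, x⟩
    refine and_congr ⟨fun h e u v huv => h (i e) u v (hlink.1 huv).1, fun h e u v huv => ?_⟩
      (forall_congr' fun v => Eq.congr_left ?_)
    · by_cases he : e.1 ∈ R
      · exact h (ρ ⟨e, he⟩) u v (hlink.2 ⟨(hρ ⟨e, he⟩ _ _).1 huv, (hEH.1 (ρ _).2).2⟩)
      · exact h ⟨e, hEH.2 ⟨e.2, he⟩⟩ u v (hlink.2 ⟨huv, he⟩)
    · have hterm : ∀ e : E(G.deleteEdges R),
          (if (G.deleteEdges R).Inc e v then (Φ (f, x)).2.2 e • (G.deleteEdges R).endSum f e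
            else 0) = (∑ r, if ρ r = e then (if G.Inc (k r) v then x (k r) • G.endSum f (k r)
              else 0) else 0) + if G.Inc (i e) v then x (i e) • G.endSum f (i e) else 0 := by
        intro e
        have h1 : (G.deleteEdges R).Inc e v ↔ G.Inc (i e) v := by
          rw [hincH]
          exact and_iff_left (hEH.1 e.2).2
        have h2 : ∀ r : R, (if ρ r = e then (if G.Inc (k r) v then x (k r) • G.endSum f (k r)
            else 0) else 0) = if G.Inc (i e) v then (if ρ r = e then x (k r) else 0) •
              G.endSum f (i e) else 0 := by
          intro r
          by_cases h : ρ r = e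
          · subst h
            rw [if_pos rfl, if_pos rfl, hsumρ]
            exact if_congr (hρinc r v).symm rfl rfl
          · simp [h]
        rw [Finset.sum_congr rfl fun r _ => h2 r, hsumH, if_congr h1 rfl rfl]
        split_ifs
        · rw [← Finset.sum_smul, ← add_smul]
          exact congrArg (· • _) (add_comm _ _)
        · simp
      rw [hsplit]
      refine Eq.trans ?_ (Finset.sum_congr rfl fun e _ => hterm e).symm
      rw [Finset.sum_add_distrib, Finset.sum_comm]
      simp
  let Ψ : {q : (R → ZMod 2) × ((V(G) → W) × (E(G.deleteEdges R) → ZMod 2)) //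
      (G.deleteEdges R).IsPenrosePair q.2} ≃
      (R → ZMod 2) × {p // (G.deleteEdges R).IsPenrosePair (W := W) p} :=
    { toFun := fun q => (q.1.1, ⟨q.1.2, q.2⟩)
      invFun := fun q => ⟨(q.1, q.2.1), q.2.2⟩
      left_inv := fun _ => rfl
      right_inv := fun _ => rfl }
  rw [numPenrosePairs, Nat.card_congr ((Equiv.subtypeEquiv Φ hΦ).trans Ψ), Nat.card_prod,
    numPenrosePairs]
  congr 1
  rw [Nat.card_fun, Nat.card_zmod, Nat.card_coe_set_eq]

end Graph

/-! ### Fibers of homomorphisms and characteristic 2 -/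

/-- Every fiber over `S` is a coset of the kernel; a section `s` over `S` trivializes them. -/
theorem AddMonoidHom.card_preimage {A B : Type*} [AddGroup A] [AddGroup B] (φ : A →+ B)
    {S : Set B} (hS : S ⊆ Set.range φ) :
    Nat.card {a // φ a ∈ S} = Nat.card S * Nat.card φ.ker := by
  choose s hs using fun b : S => hS b.2
  rw [← Nat.card_prod]
  refine Nat.card_congr
    { toFun := fun a => (⟨φ a.1, a.2⟩, ⟨a.1 - s ⟨φ a.1, a.2⟩, by
        rw [AddMonoidHom.mem_ker, map_sub, hs, sub_self]⟩)
      invFun := fun p => ⟨p.2.1 + s p.1, by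
        rw [map_add, AddMonoidHom.mem_ker.1 p.2.2, hs, zero_add]; exact p.1.2⟩
      left_inv := fun a => by simp
      right_inv := ?_ }
  rintro ⟨b, k⟩
  have h : φ (k.1 + s b) = b.1 := by rw [map_add, AddMonoidHom.mem_ker.1 k.2, hs, zero_add]
  have h' : (⟨φ (k.1 + s b), h ▸ b.2⟩ : S) = b := Subtype.ext h
  refine Prod.ext h' (Subtype.ext ?_)
  change k.1 + s b - s ⟨φ (k.1 + s b), _⟩ = k.1
  rw [h', add_sub_cancel_right]

theorem ZModModule.add_eq_zero_iff {W : Type*} [AddCommGroup W] [Module (ZMod 2) W] {a b : W} :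
    a + b = 0 ↔ a = b := by
  rw [add_eq_zero_iff_eq_neg, ZModModule.neg_eq_self]

/-! ### Cycles on the diagram and their potentials -/

namespace LinkDiagram

variable {X : Type*} {D : LinkDiagram X} {ι : Type*}

theorem exists_potential_pi [Fintype X] [DecidableEq D.Region]
    (hplane : D.IsPlane) (halt : D.IsAlternating) (G : X × ZMod 4 → ι → ZMod 2)
    (hG : ∀ d, G (rot (rot d)) = G d)
    (hsum : ∀ R : D.Region, ∑ d, (if D.region d = R then G d else 0) = 0) :
    ∃ f : D.Region → ι → ZMod 2,
      ∀ d, G d = f (D.region (rot d)) + f (D.region (rot.symm d)) := by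
  have h : ∀ i, _ := fun i => exists_potential hplane halt (fun d => G d i)
    (fun d => congrFun (hG d) i) fun R => by
      have := congrFun (hsum R) i
      rw [Finset.sum_apply] at this
      simpa only [ite_apply, Pi.zero_apply] using this
  choose f hf using h
  exact ⟨fun R i => f i R, fun d => funext fun i => hf i d⟩

/-- Half-edge labellings which are constant along arcs and sum to zero at each crossing. -/
def cycleGroup (D : LinkDiagram X) (W : Type*) [AddCommGroup W] :
    AddSubgroup (X × ZMod 4 → W) where
  carrier := {c | (∀ d, c (D.arc d) = c d) ∧ ∀ x, c (x, 0) + c (x, 1) + c (x, 2) + c (x, 3) = 0}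
  zero_mem' := by simp
  add_mem' := by
    rintro a b ⟨ha, ha'⟩ ⟨hb, hb'⟩
    refine ⟨fun d => by simp [ha, hb], fun x => ?_⟩
    have := congrArg₂ (· + ·) (ha' x) (hb' x)
    simp only [add_zero] at this
    rw [← this]
    simp only [Pi.add_apply]
    abel
  neg_mem' := by
    rintro a ⟨ha, ha'⟩
    refine ⟨fun d => by simp [ha], fun x => ?_⟩
    have := congrArg Neg.neg (ha' x)
    rw [neg_zero] at this
    rw [← this]
    simp only [Pi.neg_apply]
    abel

section Module

variable {W : Type*} [AddCommGroup W] [Module (ZMod 2) W]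

theorem cycle_add_rot {c : X × ZMod 4 → W} (hc : c ∈ D.cycleGroup W) (d : X × ZMod 4) :
    c (rot (rot d)) + c (rot (rot (rot d))) = c d + c (rot d) := by
  revert d
  rw [forall_half_edge]
  intro x
  have h := hc.2 x
  simp only [rot_apply]
  have h0 : (3 : ZMod 4) + 1 = 0 := rfl
  have h1 : (0 : ZMod 4) + 1 = 1 := rfl
  have h2 : (1 : ZMod 4) + 1 = 2 := rfl
  have h3 : (2 : ZMod 4) + 1 = 3 := rfl
  simp only [h0, h1, h2, h3]
  have key : c (x, 0) + c (x, 1) = c (x, 2) + c (x, 3) := by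
    rw [← ZModModule.add_eq_zero_iff, ← h]
    abel
  have key' : c (x, 1) + c (x, 2) = c (x, 3) + c (x, 0) := by
    rw [← ZModModule.add_eq_zero_iff, ← h]
    abel
  exact ⟨key.symm, key'.symm, key, key'⟩

theorem sum_cycle_region [Fintype X] [DecidableEq D.Region] {c : X × ZMod 4 → W}
    (hc : c ∈ D.cycleGroup W) (R : D.Region) :
    ∑ d, (if D.region d = R then c d + c (rot d) else 0) = 0 := by
  refine Eq.trans ?_ (sum_region_eq_zero ZModModule.add_self c R)
  simp only [hc.1, add_comm]

end Module

/-- The sums of adjacent labels agree at opposite corners and cancel around each region, as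
`exists_potential_pi` requires. -/
theorem exists_potential_of_cycle [Fintype X] (hplane : D.IsPlane) (halt : D.IsAlternating)
    {c : X × ZMod 4 → ι → ZMod 2} (hc : c ∈ D.cycleGroup (ι → ZMod 2)) :
    ∃ f : D.Region → ι → ZMod 2, ∀ x,
      c (x, 1) + c (x, 2) = f (D.region (x, 0)) + f (D.region (x, 2)) := by
  classical
  obtain ⟨f, hf⟩ := exists_potential_pi hplane halt (fun d => c d + c (rot d))
    (fun d => cycle_add_rot hc d) fun R => sum_cycle_region hc R
  refine ⟨f, fun x => (hf (x, 1)).trans ?_⟩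
  rw [add_comm]
  rfl

theorem isDotted_region_iff (halt : D.IsAlternating) (d : X × ZMod 4) :
    D.IsDotted (D.region d) ↔ IsOver d := by
  refine ⟨fun h => by_contra fun h' => halt.not_isDotted h' h, ?_⟩
  obtain ⟨x, i⟩ := d
  rintro (h | h) <;> simp only at h <;> subst h
  · exact ⟨x, Or.inl rfl⟩
  · exact ⟨x, Or.inr rfl⟩

/-- The converse direction: the flow `g` has a potential `F` on the dotted regions. Together with
`f` on the undotted ones it labels all regions, and the cycle sought is the difference across each
arc. -/
theorem exists_cycle [Fintype X] [DecidableEq D.Region] (hplane : D.IsPlane)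
    (halt : D.IsAlternating) (f : D.Region → ι → ZMod 2) (g : X → ι → ZMod 2)
    (hg : ∀ R, ∑ x, ((if D.region (x, 0) = R then g x else 0) +
      (if D.region (x, 2) = R then g x else 0)) = 0) :
    ∃ c ∈ D.cycleGroup (ι → ZMod 2), ∀ x,
      c (x, 1) + c (x, 2) = f (D.region (x, 0)) + f (D.region (x, 2)) ∧
      c (x, 0) + c (x, 1) = g x := by
  classical
  obtain ⟨F, hF⟩ := exists_potential_pi hplane halt
    (fun d => if IsOver d then 0 else g d.1) (by
      rw [forall_half_edge]
      exact fun x => ⟨rfl, rfl, rfl, rfl⟩) (fun R => by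
      rw [sum_half_edges]
      refine Eq.trans ?_ (hg R)
      simp [not_isOver_zero, not_isOver_two, isOver_one, isOver_three])
  let h : D.Region → ι → ZMod 2 := fun R => if D.IsDotted R then F R else f R
  have h0 : ∀ x, h (D.region (x, 0)) = f (D.region (x, 0)) := fun x => by
    simp [h, isDotted_region_iff halt, not_isOver_zero]
  have h1 : ∀ x, h (D.region (x, 1)) = F (D.region (x, 1)) := fun x => by
    simp [h, isDotted_region_iff halt, isOver_one]
  have h2 : ∀ x, h (D.region (x, 2)) = f (D.region (x, 2)) := fun x => by
    simp [h, isDotted_region_iff halt, not_isOver_two]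
  have h3 : ∀ x, h (D.region (x, 3)) = F (D.region (x, 3)) := fun x => by
    simp [h, isDotted_region_iff halt, isOver_three]
  have c0 : ∀ x, h (D.region (x, 0)) + h (D.region (D.arc (x, 0))) =
      f (D.region (x, 0)) + F (D.region (x, 3)) := fun x => by
    rw [← region_rot_symm, h0, ← h3]; rfl
  have c1 : ∀ x, h (D.region (x, 1)) + h (D.region (D.arc (x, 1))) =
      F (D.region (x, 1)) + f (D.region (x, 0)) := fun x => by
    rw [← region_rot_symm, h1, ← h0]; rfl
  have c2 : ∀ x, h (D.region (x, 2)) + h (D.region (D.arc (x, 2))) =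
      f (D.region (x, 2)) + F (D.region (x, 1)) := fun x => by
    rw [← region_rot_symm, h2, ← h1]; rfl
  have c3 : ∀ x, h (D.region (x, 3)) + h (D.region (D.arc (x, 3))) =
      F (D.region (x, 3)) + f (D.region (x, 2)) := fun x => by
    rw [← region_rot_symm, h3, ← h2]; rfl
  have hself : ∀ w : ι → ZMod 2, w + w = 0 := ZModModule.add_self
  refine ⟨fun d => h (D.region d) + h (D.region (D.arc d)), ⟨fun d => ?_, fun x => ?_⟩,
    fun x => ⟨?_, ?_⟩⟩
  · simp only [D.arc_arc]
    exact add_comm _ _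
  · simp only [c0, c1, c2, c3]
    linear_combination hself (f (D.region (x, 0))) + hself (f (D.region (x, 2))) +
      hself (F (D.region (x, 1))) + hself (F (D.region (x, 3)))
  · simp only [c1, c2]
    linear_combination hself (F (D.region (x, 1)))
  · simp only [c0, c1]
    have hx : g x = F (D.region (x, 1)) + F (D.region (x, 3)) :=
      (if_neg (not_isOver_zero x)).symm.trans (hF (x, 0))
    linear_combination hself (f (D.region (x, 0))) - hx

theorem apply_eq_of_region_eq {α : Type*} {c : X × ZMod 4 → α}
    (hc : ∀ d, c (D.faceNext d) = c d) {d e : X × ZMod 4} (h : D.region d = D.region e) :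
    c d = c e := by
  obtain ⟨k, rfl⟩ : D.faceNext.SameCycle d e :=
    Quotient.exact (s := Equiv.Perm.SameCycle.setoid D.faceNext) h
  have key : ∀ k : ℤ, ∀ d, c ((D.faceNext ^ k) d) = c d := fun k => by
    induction k using Int.induction_on with
    | zero => simp
    | succ k ih => 
      intro d
      rw [zpow_add_one, Equiv.Perm.mul_apply, ih, hc]
    | pred k ih =>
      intro d
      rw [zpow_sub_one, Equiv.Perm.mul_apply, ih, ← hc, ← Equiv.Perm.mul_apply, mul_inv_cancel]
      rfl
  exact (key k d).symm

end LinkDiagram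

/-! ### The dual Tait graph and the two homomorphisms -/

namespace LinkDiagram

variable {X : Type*} {D : LinkDiagram X} {W : Type*} [AddCommGroup W]

/-- The vertex of the dual Tait graph at the corner `(x, 0)`. -/
def tail (halt : D.IsAlternating) (x : X) : V(D.dualTaitGraph halt) :=
  ⟨D.region (x, 0), halt.not_isDotted (not_isOver_zero x)⟩

/-- The vertex of the dual Tait graph at the corner `(x, 2)`. -/
def head (halt : D.IsAlternating) (x : X) : V(D.dualTaitGraph halt) :=
  ⟨D.region (x, 2), halt.not_isDotted (not_isOver_two x)⟩

theorem isLink_tail_head (halt : D.IsAlternating) (x : X) :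
    (D.dualTaitGraph halt).IsLink x (tail halt x) (head halt x) := Or.inl ⟨rfl, rfl⟩

theorem inc_dualTaitGraph_iff (halt : D.IsAlternating) (x : X) (R : D.Region) :
    (D.dualTaitGraph halt).Inc x R ↔ D.region (x, 0) = R ∨ D.region (x, 2) = R := by
  constructor
  · rintro ⟨_, ⟨h, -⟩ | ⟨h, -⟩⟩
    exacts [Or.inl h.symm, Or.inr h.symm]
  · rintro (rfl | rfl)
    exacts [⟨_, Or.inl ⟨rfl, rfl⟩⟩, ⟨_, Or.inr ⟨rfl, rfl⟩⟩]

theorem exists_region_eq (halt : D.IsAlternating) (v : V(D.dualTaitGraph halt)) :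
    ∃ x, v = tail halt x ∨ v = head halt x := by
  obtain ⟨R, hR⟩ := v
  obtain ⟨⟨x, i⟩, rfl⟩ := D.region_surjective R
  refine ⟨x, ?_⟩
  have hi : ¬ IsOver (x, i) := fun h => hR ((isDotted_region_iff halt _).2 h)
  have hi' : i = 0 ∨ i = 2 := by
    have key : ∀ j : ZMod 4, ¬ (j = 1 ∨ j = 3) → j = 0 ∨ j = 2 := by decide
    exact key i hi
  rcases hi' with rfl | rfl
  exacts [Or.inl rfl, Or.inr rfl]

variable (D W) in
/-- The labellings of the two kinds of opposite pairs of corners given by a labelling of the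
half-edges. -/
def cycleHom : D.cycleGroup W →+ (X → W) × (X → W) where
  toFun c := (fun x => c.1 (x, 1) + c.1 (x, 2), fun x => c.1 (x, 0) + c.1 (x, 1))
  map_zero' := by ext <;> simp
  map_add' a b := by ext x <;> simp <;> abel

variable (W) in
/-- The coboundary of a vertex labelling of the dual Tait graph, next to an edge labelling. -/
def coboundaryHom (halt : D.IsAlternating) :
    (V(D.dualTaitGraph halt) → W) × (X → W) →+ (X → W) × (X → W) where
  toFun p := (fun x => p.1 (tail halt x) + p.1 (head halt x), p.2)
  map_zero' := by ext <;> simp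
  map_add' a b := by ext x <;> simp; abel

open Classical in
variable (W) in
/-- The pairs of a nowhere zero coboundary and a flow on the dual Tait graph whose value at each
edge is zero or agrees with the coboundary. -/
def taitPairs [Fintype X] (halt : D.IsAlternating) : Set ((X → W) × (X → W)) :=
  {p | (∃ f : V(D.dualTaitGraph halt) → W, p.1 = fun x => f (tail halt x) + f (head halt x)) ∧
    (∀ R, ∑ x, ((if D.region (x, 0) = R then p.2 x else 0) +
      (if D.region (x, 2) = R then p.2 x else 0)) = 0) ∧
    ∀ x, p.1 x ≠ 0 ∧ (p.2 x = 0 ∨ p.2 x = p.1 x)}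

theorem taitPairs_subset_range_coboundaryHom [Fintype X] (halt : D.IsAlternating) :
    taitPairs W halt ⊆ Set.range (coboundaryHom W halt) := by
  rintro ⟨_, g⟩ ⟨⟨f, rfl⟩, -⟩
  exact ⟨(f, g), rfl⟩

theorem taitPairs_subset_range_cycleHom [Fintype X] {ι : Type*} (hplane : D.IsPlane)
    (halt : D.IsAlternating) :
    taitPairs (ι → ZMod 2) halt ⊆ Set.range (D.cycleHom (ι → ZMod 2)) := by
  classical
  rintro ⟨_, g⟩ ⟨⟨f, rfl⟩, hg, -⟩
  obtain ⟨c, hc, h⟩ := exists_cycle hplane halt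
    -- Only undotted regions enter the required sum; the value 0 on the dotted ones is arbitrary.
    (fun R => if hR : ¬ D.IsDotted R then f ⟨R, hR⟩ else 0) g (by convert hg)
  refine ⟨⟨c, hc⟩, Prod.ext (funext fun x => ?_) (funext fun x => (h x).2)⟩
  refine (h x).1.trans (congrArg₂ _ ?_ ?_)
  · exact dif_pos (tail halt x).2
  · exact dif_pos (head halt x).2

section Module

variable [Module (ZMod 2) W]

/-- Both kernels consist of one vector for each connected piece: a cycle with vanishing sums is
constant on the piece, and so is a vertex labelling with zero coboundary. -/
theorem card_ker_cycleHom (halt : D.IsAlternating) :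
    Nat.card (D.cycleHom W).ker = Nat.card (coboundaryHom W halt).ker := by
  classical
  refine (Nat.card_congr (Equiv.ofBijective
    (fun p : (coboundaryHom W halt).ker => (⟨⟨fun d => p.1.1 (tail halt d.1), ?_, ?_⟩, ?_⟩ :
      (D.cycleHom W).ker)) ⟨?_, ?_⟩)).symm
  · intro d
    have hf : ∀ x, p.1.1 (tail halt x) = p.1.1 (head halt x) := fun x =>
      ZModModule.add_eq_zero_iff.1 (congrFun (congrArg Prod.fst p.2) x)
    let f : D.Region → W := fun R => if hR : ¬ D.IsDotted R then p.1.1 ⟨R, hR⟩ else 0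
    have h0 : ∀ x, f (D.region (x, 0)) = p.1.1 (tail halt x) := fun x => dif_pos (tail halt x).2
    have h2 : ∀ x, f (D.region (x, 2)) = p.1.1 (head halt x) := fun x => dif_pos (head halt x).2
    have h1 : ∀ x i, IsOver (x, i) → f (D.region (x, i)) = 0 := fun x i hi =>
      dif_neg (not_not.2 ((isDotted_region_iff halt (x, i)).2 hi))
    have := halt.apply_region_arc (f := f) (fun x => ⟨by rw [h0, h2, hf],
      by rw [h1 x 1 (isOver_one x), h1 x 3 (isOver_three x)]⟩) d false
    simp only [cond_false, h0] at this
    exact this.symm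
  · intro x
    simp only [ZModModule.add_self, zero_add]
  · exact Prod.ext (funext fun x => ZModModule.add_self _) (funext fun x => ZModModule.add_self _)
  · rintro ⟨⟨f, g⟩, h⟩ ⟨⟨f', g'⟩, h'⟩ heq
    have hx : ∀ x, f (tail halt x) = f' (tail halt x) := fun x =>
      congrFun (congrArg (fun c : (D.cycleHom W).ker => c.1.1) heq) (x, 0)
    have hf : ∀ x, f (tail halt x) = f (head halt x) := fun x =>
      ZModModule.add_eq_zero_iff.1 (congrFun (congrArg Prod.fst h) x)
    have hf' : ∀ x, f' (tail halt x) = f' (head halt x) := fun x =>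
      ZModModule.add_eq_zero_iff.1 (congrFun (congrArg Prod.fst h') x)
    have hg : g = 0 := congrArg Prod.snd h
    have hg' : g' = 0 := congrArg Prod.snd h'
    refine Subtype.ext (Prod.ext (funext fun v => ?_) (hg.trans hg'.symm))
    obtain ⟨x, rfl | rfl⟩ := exists_region_eq halt v
    · exact hx x
    · change f _ = f' _
      rw [← hf, ← hf', hx]
  · rintro ⟨⟨c, harc, hsum⟩, hc⟩
    have h12 : ∀ x, c (x, 1) = c (x, 2) := fun x =>
      ZModModule.add_eq_zero_iff.1 (congrFun (congrArg Prod.fst hc) x)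
    have h01 : ∀ x, c (x, 0) = c (x, 1) := fun x =>
      ZModModule.add_eq_zero_iff.1 (congrFun (congrArg Prod.snd hc) x)
    have h23 : ∀ x, c (x, 2) = c (x, 3) := fun x => by
      have := hsum x
      rwa [h01, ZModModule.add_self, zero_add, ZModModule.add_eq_zero_iff] at this
    have hconst : ∀ d : X × ZMod 4, c d = c (d.1, 0) := by
      rw [forall_half_edge]
      intro x
      simp only [h01, h12, h23, and_self]
    have hface : ∀ d, c (D.faceNext d) = c d := fun d => by
      rw [← harc d, ← rot_faceNext, hconst, hconst (rot _)]
      rfl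
    have hout : ∀ d, c (D.region d).out = c d := fun d =>
      apply_eq_of_region_eq hface (Quotient.out_eq (D.region d))
    -- `c` is constant around each region, so any corner of the region gives the vertex label.
    refine ⟨⟨(fun v => c v.1.out, 0), Prod.ext (funext fun x => ?_) rfl⟩,
      Subtype.ext (Subtype.ext (funext fun d => ?_))⟩
    · change c (D.region (x, 0)).out + c (D.region (x, 2)).out = 0
      rw [hout, hout, h01, h12, ZModModule.add_self]
    · exact (hout (d.1, 0)).trans (hconst d).symm

/-! ### From Tait colorings to Penrose pairs -/

/-- The two ways of matching the colors at the ends of a matching edge are the two values of the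
flow: `c (x, 1) = c (x, 0)` makes it zero, `c (x, 2) = c (x, 0)` makes it equal to the coboundary.
-/
theorem isTaitColoring_iff_of_equiv [Fintype X] {ι : Type*} (hplane : D.IsPlane)
    (halt : D.IsAlternating) {n : ℕ} (e : (ι → ZMod 2) ≃ Fin n)
    (c : X × ZMod 4 → ι → ZMod 2) :
    D.IsTaitColoring (e ∘ c) ↔ ∃ h : c ∈ D.cycleGroup (ι → ZMod 2),
      D.cycleHom (ι → ZMod 2) ⟨c, h⟩ ∈ taitPairs (ι → ZMod 2) halt := by
  classical
  simp only [isTaitColoring_iff, Setoid.ker_def, Function.comp_apply, e.injective.eq_iff]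
  have hself : ∀ w : ι → ZMod 2, w + w = 0 := ZModModule.add_self
  constructor
  · rintro ⟨harc, hx⟩
    have hc : c ∈ D.cycleGroup (ι → ZMod 2) := by
      refine ⟨harc, fun x => ?_⟩
      rcases (hx x).2 with ⟨h1, h2⟩ | ⟨h1, h2⟩
      · linear_combination hself (c (x, 0)) + hself (c (x, 1)) - h1 + h2
      · linear_combination hself (c (x, 0)) + hself (c (x, 2)) + h1 - h2
    refine ⟨hc, ?_, fun R => ?_, fun x => ⟨?_, ?_⟩⟩
    · obtain ⟨f, hf⟩ := exists_potential_of_cycle hplane halt hc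
      exact ⟨fun v => f v.1, funext hf⟩
    · by_cases hR : D.IsDotted R
      · refine Finset.sum_eq_zero fun x _ => ?_
        rw [if_neg, if_neg, add_zero]
        · rintro rfl
          exact (head halt x).2 hR
        · rintro rfl
          exact (tail halt x).2 hR
      · refine Eq.trans ?_ (sum_cycle_region hc R)
        rw [sum_half_edges]
        refine Finset.sum_congr rfl fun x _ => ?_
        have h1 : D.region (x, 1) ≠ R := by
          rintro rfl
          exact hR ((isDotted_region_iff halt _).2 (isOver_one x))
        have h3 : D.region (x, 3) ≠ R := by
          rintro rfl
          exact hR ((isDotted_region_iff halt _).2 (isOver_three x))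
        have hrot : c (x, 2) + c (rot (x, 2)) = c (x, 0) + c (x, 1) := cycle_add_rot hc (x, 0)
        rw [if_neg h1, if_neg h3, add_zero, add_zero, hrot]
        rfl
    · exact fun h => (hx x).1 (ZModModule.add_eq_zero_iff.1 h)
    · change c (x, 0) + c (x, 1) = 0 ∨ c (x, 0) + c (x, 1) = c (x, 1) + c (x, 2)
      rcases (hx x).2 with ⟨h1, h2⟩ | ⟨h1, h2⟩
      · rw [h2, add_comm]
        exact Or.inr rfl
      · rw [h1]
        exact Or.inl (hself _)
  · rintro ⟨⟨harc, hsum⟩, -, -, hx⟩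
    refine ⟨harc, fun x => ⟨fun h => (hx x).1 (ZModModule.add_eq_zero_iff.2 h), ?_⟩⟩
    rcases (hx x).2 with h | h
    · have h : c (x, 0) + c (x, 1) = 0 := h
      have hs := hsum x
      rw [h, zero_add] at hs
      exact Or.inr ⟨(ZModModule.add_eq_zero_iff.1 h).symm, ZModModule.add_eq_zero_iff.1 hs⟩
    · have h : c (x, 0) + c (x, 1) = c (x, 1) + c (x, 2) := h
      have h02 : c (x, 0) = c (x, 2) := by linear_combination h
      refine Or.inl ⟨?_, h02.symm⟩
      rw [← ZModModule.add_eq_zero_iff]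
      linear_combination hsum x - h02 - hself (c (x, 2))

theorem numTaitColorings_eq_card [Fintype X] {ι : Type*} (hplane : D.IsPlane)
    (halt : D.IsAlternating) {n : ℕ} (e : (ι → ZMod 2) ≃ Fin n) :
    D.numTaitColorings n = Nat.card {c // D.cycleHom (ι → ZMod 2) c ∈ taitPairs _ halt} := by
  let e' : {c : X × ZMod 4 → ι → ZMod 2 // D.IsTaitColoring (e ∘ c)} ≃
      {c // D.cycleHom (ι → ZMod 2) c ∈ taitPairs _ halt} :=
    { toFun := fun c => ⟨⟨c.1, ((isTaitColoring_iff_of_equiv hplane halt e c.1).1 c.2).1⟩,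
        ((isTaitColoring_iff_of_equiv hplane halt e c.1).1 c.2).2⟩
      invFun := fun c => ⟨c.1.1, (isTaitColoring_iff_of_equiv hplane halt e c.1.1).2 ⟨c.1.2, c.2⟩⟩
      left_inv := fun _ => rfl
      right_inv := fun _ => rfl }
  refine Nat.card_congr (Equiv.trans (Equiv.symm ?_) e')
  exact Equiv.subtypeEquiv (Equiv.arrowCongr (Equiv.refl _) e) fun c => Iff.rfl

/-- A loop is counted once on the left and twice on the right, hence `hloop`. -/
theorem sum_inc_eq [Fintype X] [DecidableEq D.Region] (halt : D.IsAlternating)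
    [Fintype E(D.dualTaitGraph halt)] {M : Type*} [AddCommMonoid M]
    (hloop : ∀ x, tail halt x ≠ head halt x) (F : E(D.dualTaitGraph halt) → M) (R : D.Region)
    [∀ x, Decidable ((D.dualTaitGraph halt).Inc x R)] :
    ∑ x : E(D.dualTaitGraph halt), (if (D.dualTaitGraph halt).Inc x R then F x else 0) =
      ∑ x, ((if D.region (x, 0) = R then F ⟨x, Set.mem_univ x⟩ else 0) +
        (if D.region (x, 2) = R then F ⟨x, Set.mem_univ x⟩ else 0)) := by
  let e : E(D.dualTaitGraph halt) ≃ X := Equiv.Set.univ X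
  refine Fintype.sum_equiv e _ _ ?_
  rintro ⟨x, hx⟩
  simp only [inc_dualTaitGraph_iff]
  change _ = (if D.region (x, 0) = R then F ⟨x, hx⟩ else 0) +
    (if D.region (x, 2) = R then F ⟨x, hx⟩ else 0)
  by_cases h0 : D.region (x, 0) = R
  · have h2 : D.region (x, 2) ≠ R := fun h2 => hloop x (Subtype.ext (h0.trans h2.symm))
    simp [h0, h2]
  · simp [h0]

theorem isPenrosePair_dualTaitGraph_iff [Fintype X] (halt : D.IsAlternating)
    [Fintype E(D.dualTaitGraph halt)] (f : V(D.dualTaitGraph halt) → W)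
    (y : E(D.dualTaitGraph halt) → ZMod 2) :
    (D.dualTaitGraph halt).IsPenrosePair (f, y) ↔
      coboundaryHom W halt (f, fun x => y ⟨x, Set.mem_univ x⟩ •
        (f (tail halt x) + f (head halt x))) ∈ taitPairs W halt := by
  classical
  have hend : ∀ x : X, (D.dualTaitGraph halt).endSum f ⟨x, Set.mem_univ x⟩ =
      f (tail halt x) + f (head halt x) := fun x =>
    Graph.endSum_eq f (e := ⟨x, Set.mem_univ x⟩) (isLink_tail_head halt x)
  have hsum : (∀ x, tail halt x ≠ head halt x) → ∀ R : D.Region,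
      (∑ x : E(D.dualTaitGraph halt), if (D.dualTaitGraph halt).Inc x R then
        y x • (D.dualTaitGraph halt).endSum f x else 0) =
      ∑ x, ((if D.region (x, 0) = R then y ⟨x, Set.mem_univ x⟩ •
          (f (tail halt x) + f (head halt x)) else 0) +
        (if D.region (x, 2) = R then y ⟨x, Set.mem_univ x⟩ •
          (f (tail halt x) + f (head halt x)) else 0)) := fun hloop R =>
    (sum_inc_eq halt hloop _ R).trans (by simp only [hend])
  constructor
  · rintro ⟨h1, h2⟩
    have h3 : ∀ x, f (tail halt x) ≠ f (head halt x) := fun x =>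
      h1 ⟨x, Set.mem_univ x⟩ _ _ (isLink_tail_head halt x)
    refine ⟨⟨f, rfl⟩, fun R => ?_, fun x => ⟨fun h => h3 x (ZModModule.add_eq_zero_iff.1 h), ?_⟩⟩
    · by_cases hR : D.IsDotted R
      · refine Finset.sum_eq_zero fun x _ => ?_
        rw [if_neg, if_neg, add_zero]
        · rintro rfl
          exact (head halt x).2 hR
        · rintro rfl
          exact (tail halt x).2 hR
      · exact (hsum (fun x hx => h3 x (congrArg f hx)) R).symm.trans (h2 ⟨R, hR⟩)
    · have hy : ∀ z : ZMod 2, z = 0 ∨ z = 1 := by decide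
      change y _ • _ = (0 : W) ∨ y _ • _ = _
      rcases hy (y ⟨x, Set.mem_univ x⟩) with h | h <;> rw [h]
      · exact Or.inl (zero_smul _ _)
      · exact Or.inr (one_smul _ _)
  · rintro ⟨-, h2, h1⟩
    have h3 : ∀ x, f (tail halt x) ≠ f (head halt x) := fun x h =>
      (h1 x).1 (ZModModule.add_eq_zero_iff.2 h)
    refine ⟨?_, fun v => ?_⟩
    · rintro ⟨x, hx⟩ ⟨u, hu⟩ ⟨v, hv⟩ (⟨h, h'⟩ | ⟨h, h'⟩) <;> simp only at h h' <;> subst h h'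
      · exact h3 x
      · exact (h3 x).symm
    · exact (hsum (fun x hx => h3 x (congrArg f hx)) v.1).trans (h2 v.1)

theorem card_coboundaryHom_preimage [Fintype X] (halt : D.IsAlternating)
    [Fintype E(D.dualTaitGraph halt)] :
    Nat.card {p // coboundaryHom W halt p ∈ taitPairs W halt} =
      (D.dualTaitGraph halt).numPenrosePairs W := by
  classical
  refine (Nat.card_congr (Equiv.ofBijective (fun p : {p : (V(D.dualTaitGraph halt) → W) ×
      (E(D.dualTaitGraph halt) → ZMod 2) // (D.dualTaitGraph halt).IsPenrosePair p} =>
    ⟨_, (isPenrosePair_dualTaitGraph_iff halt p.1.1 p.1.2).1 p.2⟩) ⟨?_, ?_⟩)).symm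
  · rintro ⟨⟨f, y⟩, h⟩ ⟨⟨f', y'⟩, h'⟩ heq
    obtain ⟨hf, hy⟩ := Prod.ext_iff.1 (Subtype.ext_iff.1 heq)
    simp only at hf hy
    subst hf
    refine Subtype.ext (Prod.ext rfl (funext ?_))
    rintro ⟨x, hx⟩
    have hne : f (tail halt x) + f (head halt x) ≠ 0 := fun h0 =>
      h.1 ⟨x, hx⟩ _ _ (isLink_tail_head halt x) (ZModModule.add_eq_zero_iff.1 h0)
    -- Over the field `ZMod 2` a coefficient is determined by its multiple of the nonzero vector
    -- `hne`.
    have : Fact (Nat.Prime 2) := ⟨Nat.prime_two⟩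
    exact smul_left_injective _ hne (congrFun hy x)
  · rintro ⟨⟨f, g⟩, h⟩
    have hg : (fun x => (if g x = 0 then (0 : ZMod 2) else 1) •
        (f (tail halt x) + f (head halt x))) = g := by
      funext x
      split_ifs with h0
      · rw [zero_smul, h0]
      · rw [one_smul]
        exact ((h.2.2 x).2.resolve_left h0).symm
    have h' : coboundaryHom W halt (f, fun x => (if g x = 0 then (0 : ZMod 2) else 1) •
        (f (tail halt x) + f (head halt x))) ∈ taitPairs W halt := by rwa [hg]
    exact ⟨⟨(f, fun x => if g x.1 = 0 then 0 else 1),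
      (isPenrosePair_dualTaitGraph_iff halt _ _).2 h'⟩, Subtype.ext (Prod.ext rfl hg)⟩

end Module

/-- For a plane alternating diagram, the Tait colorings with `2 ^ k` colors are equinumerous with
the Penrose pairs of the dual Tait graph. -/
theorem numTaitColorings_two_pow [Fintype X] (hplane : D.IsPlane) (halt : D.IsAlternating)
    [Fintype E(D.dualTaitGraph halt)] (k : ℕ) :
    D.numTaitColorings (2 ^ k) = (D.dualTaitGraph halt).numPenrosePairs (Fin k → ZMod 2) := by
  have e : (Fin k → ZMod 2) ≃ Fin (2 ^ k) := Fintype.equivFinOfCardEq (by simp)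
  rw [numTaitColorings_eq_card hplane halt e,
    AddMonoidHom.card_preimage _ (taitPairs_subset_range_cycleHom hplane halt),
    card_ker_cycleHom halt, ← card_coboundaryHom_preimage,
    AddMonoidHom.card_preimage _ (taitPairs_subset_range_coboundaryHom halt)]

end LinkDiagram

/-- The hypothesis `hred` is not needed: if the dual Tait graph has a loop, both polynomials are
zero. -/
theorem mainTheorem6 {X Y : Type*} [Finite X] [Finite Y]
    (D : LinkDiagram X) (hplane : D.IsPlane) (halt : D.IsAlternating) (hred : D.IsSemiReduced)
    (R : Set X) (hR : (D.dualTaitGraph halt).LeavesOneEdge R)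
    (D' : LinkDiagram Y) (hplane' : D'.IsPlane) (halt' : D'.IsAlternating)
    (hD' : (D'.dualTaitGraph halt').IsIsomorphic ((D.dualTaitGraph halt).deleteEdges R)) :
    D.pkPolynomial = 2 ^ R.ncard * D'.pkPolynomial := by
  have := Fintype.ofFinite X
  have := Fintype.ofFinite Y
  have := Fintype.ofFinite E(D.dualTaitGraph halt)
  have := Fintype.ofFinite E(D'.dualTaitGraph halt')
  have := Fintype.ofFinite E((D.dualTaitGraph halt).deleteEdges R)
  have hP := D.existsUnique_pkPolynomial.choose_spec.1
  have hP' := D'.existsUnique_pkPolynomial.choose_spec.1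
  refine Polynomial.eq_of_infinite_eval_eq _ _ ?_
  -- Comparison at the infinitely many points `2 ^ k`.
  refine Set.infinite_of_injective_forall_mem (f := fun k : ℕ => ((2 ^ k : ℕ) : ℤ))
    (fun a b h => Nat.pow_right_injective le_rfl (Nat.cast_injective h)) fun k => ?_
  have hk := D.numTaitColorings_two_pow hplane halt k
  rw [Graph.numPenrosePairs_deleteEdges hR, ← Graph.numPenrosePairs_congr hD',
    ← D'.numTaitColorings_two_pow hplane' halt'] at hk
  change D.pkPolynomial.eval _ = (2 ^ R.ncard * D'.pkPolynomial).eval _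
  have h2 : (2 : ℤ[X]) = C 2 := rfl
  rw [h2, ← C_pow, eval_C_mul, LinkDiagram.pkPolynomial, LinkDiagram.pkPolynomial,
    hP _ (pow_pos two_pos k), hP' _ (pow_pos two_pos k), hk]
  push_cast
  rfl
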